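/- **Theorem.** Let $\Sigma$ be a non-empty finite alphabet, let $L\subseteq\Sigma^*$ be a regular language, let $M$ be its syntactic monoid, i.e. the quotient of $\Sigma^*$ by the congruence $s\equiv_L t\iff(\forall u,v\in\Sigma^*:\ usv\in L\Leftrightarrow utv\in L)$, and let $\mathcal A$ be a minimal DFA accepting $L$. The following are equivalent: 1. $L$ is a left-deterministic polynomial, that is, a finite disjoint union of languages of the form $\Sigma_0^*a_1\Sigma_1^*\cdots a_n\Sigma_n^*$ with $n\ge 0$, $\Sigma_0,\dots,\Sigma_n\subseteq\Sigma$, $a_1,\dots,a_n\in\Sigma$ and $a_k\notin\Sigma_{k-1}$ for every $k\in\{1,\dots,n\}$. 2. $M$ is $\mathcal R$-trivial: for all $s,t\in M$, $sM=tM$ implies $s=t$. 3. $\mathcal A$ is partially ordered: there is a partial order $\preceq$ on its states such that $q\preceq\delta(q,a)$ for every state $q$ and every symbol $a$ for which $\delta(q,a)$ is defined. 4. $L$ is definable in past temporal logic: there is a formula $\psi$, built from atoms $\pi_a$ ($a\in\Sigma$) with $\land$, $\lnot$ and $\mathbf P$, such that $L=\{w : w,|w|+1\models\psi\}$. Here $w,n\models\pi_a$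 iff the $n$-th symbol of $w$ exists and is $a$; $w,n\models\mathbf P\psi$ iff $w,m\models\psi$ for some $1\le m<n$; and $\land$, $\lnot$ have their usual meaning. In (3), "minimal DFA" may be read in either of the two customary ways, and the equivalence holds for both: a DFA accepting $L$ with the least number of states among the DFAs with a total transition function accepting $L$, or one with the least number of states among the DFAs accepting $L$ whose transition function may be partial (a string is rejected if an undefined transition is met). -/

import Mathlib

namespace PastLogic

universe u v

variable {α : Type u} {σ : Type v}

/-! ### Past temporal logic -/

/-- Formulas of the past fragment of linear temporal logic over the alphabet `α`: atoms `π_a`,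
conjunction, negation, and the temporal operator `P` (past). -/
inductive Formula (α : Type u) : Type u
  | atom (a : α) : Formula α
  | and (φ ψ : Formula α) : Formula α
  | not (φ : Formula α) : Formula α
  | past (φ : Formula α) : Formula α

/-- `φ.Sat w n`: the string `w` satisfies `φ` at position `n`. Positions are numbered from `0`, so
the positions inside `w` are `0, …, w.length - 1`, and `w.length` is the position just beyond the
end, where no atom holds. The operator `P` is strict. -/
def Formula.Sat (w : List α) : Formula α → ℕ → Prop
  | .atom a, n => w[n]? = some a
  | .and φ ψ, n => φ.Sat w n ∧ ψ.Sat w n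
  | .not φ, n => ¬ φ.Sat w n
  | .past φ, n => ∃ m, m < n ∧ φ.Sat w m

/-- The language defined by a formula: the strings satisfying it at the position just beyond their
end. -/
def Formula.language (φ : Formula α) : Language α := {w | φ.Sat w w.length}

/-- `L` is definable by a formula of past temporal logic. -/
def IsDefinable (L : Language α) : Prop := ∃ φ : Formula α, φ.language = L

/-! ### Left-deterministic polynomials -/

/-- `S*`, the language of all strings over the subalphabet `S`. -/
def stringsOver (S : Set α) : Language α := {w | ∀ a ∈ w, a ∈ S}

/-- `monomial [(S₀, a₁), (S₁, a₂), …, (Sₙ₋₁, aₙ)] Sₙ` is the monomial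
`S₀* a₁ S₁* a₂ ⋯ aₙ Sₙ*`. -/
def monomial : List (Set α × α) → Set α → Language α
  | [], S => stringsOver S
  | (S₀, a) :: l, S => stringsOver S₀ * {[a]} * monomial l S

/-- `L` is a left-deterministic monomial: `L = S₀* a₁ S₁* a₂ ⋯ aₙ Sₙ*` with `aₖ ∉ Sₖ₋₁` for
all `k = 1, …, n`. -/
def IsLeftDetMonomial (L : Language α) : Prop :=
  ∃ (l : List (Set α × α)) (S : Set α), (∀ p ∈ l, p.2 ∉ p.1) ∧ L = monomial l S

/-- `L` is a left-deterministic polynomial: a finite disjoint union of left-deterministic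
monomials. -/
def IsLeftDetPolynomial (L : Language α) : Prop :=
  ∃ F : Set (Language α), F.Finite ∧ (∀ K ∈ F, IsLeftDetMonomial K) ∧
    F.Pairwise (fun K K' => Disjoint K K') ∧ ∀ w, w ∈ L ↔ ∃ K ∈ F, w ∈ K

/-! ### The syntactic monoid -/

/-- The syntactic congruence of `L`: `s ≡ t` iff `u s v ∈ L ↔ u t v ∈ L` for all strings
`u`, `v`. -/
def syntacticCon (L : Language α) : Con (FreeMonoid α) where
  r s t := ∀ u v : FreeMonoid α,
    FreeMonoid.toList (u * s * v) ∈ L ↔ FreeMonoid.toList (u * t * v) ∈ L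
  iseqv :=
    ⟨fun _ _ _ => Iff.rfl, fun h u v => (h u v).symm, fun h h' u v => (h u v).trans (h' u v)⟩
  mul' := by
    intro s s' t t' h h' u v
    have h₁ := h u (t * v)
    have h₂ := h' (u * s') v
    simp only [mul_assoc] at h₁ h₂ ⊢
    exact h₁.trans h₂

/-- The syntactic monoid of `L`: the quotient of the free monoid by the syntactic congruence. -/
abbrev SyntacticMonoid (L : Language α) : Type u := (syntacticCon L).Quotient

/-- A monoid `M` is `R`-trivial if `sM = tM` implies `s = t`. -/
def IsRTrivial (M : Type u) [Monoid M] : Prop :=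
  ∀ s t : M, (Set.range fun x : M => s * x) = (Set.range fun x : M => t * x) → s = t

/-! ### Partially ordered deterministic automata -/

/-- `A` accepts `L` and has the least number of states among the finite deterministic automata
(with a total transition function) that accept `L`. -/
def IsMinimalDFA (A : DFA α σ) (L : Language α) : Prop :=
  A.accepts = L ∧ ∀ (n : ℕ) (B : DFA α (Fin n)), B.accepts = L → Nat.card σ ≤ n

/-- A partial order on the states exists that every transition respects. -/
def IsPartiallyOrderedDFA (A : DFA α σ) : Prop :=
  ∃ _ : PartialOrder σ, ∀ (q : σ) (a : α), q ≤ A.step q a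

/-- A deterministic automaton whose transition function may be undefined (`none`) for some
states and symbols; the automaton then rejects. -/
structure PartialDFA (α : Type u) (σ : Type v) where
  step : σ → α → Option σ
  start : σ
  accept : Set σ

/-- The state after reading a string from the state `q`, if all transitions are defined. -/
def PartialDFA.evalFrom (A : PartialDFA α σ) : σ → List α → Option σ
  | q, [] => some q
  | q, a :: w => (A.step q a).bind fun q' => A.evalFrom q' w

/-- The language accepted by a deterministic automaton with a partial transition function. -/
def PartialDFA.accepts (A : PartialDFA α σ) : Language α :=
  {w | ∃ q ∈ A.accept, A.evalFrom A.start w = some q}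

/-- `A` accepts `L` and has the least number of states among the finite deterministic automata
with a possibly partial transition function that accept `L`. -/
def PartialDFA.IsMinimal (A : PartialDFA α σ) (L : Language α) : Prop :=
  A.accepts = L ∧ ∀ (n : ℕ) (B : PartialDFA α (Fin n)), B.accepts = L → Nat.card σ ≤ n

/-- A partial order on the states exists that every defined transition respects. -/
def PartialDFA.IsPartiallyOrdered (A : PartialDFA α σ) : Prop :=
  ∃ _ : PartialOrder σ, ∀ (q : σ) (a : α) (q' : σ), A.step q a = some q' → q ≤ q'

end PastLogic

namespace PastLogic

universe u v w

variable {α : Type u} {σ : Type v} {τ : Type w}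

/-! ### Languages whose left quotients are partially ordered -/

/-! All conditions are tied to one property of the left quotients of `L`: reading letters never
leaves a quotient and later returns to it. In a minimal automaton the states are the quotients (only
the nonempty ones, if transitions may be missing and `L` is nonempty), so this property makes
reachability a partial order; conversely, every finite partially ordered automaton, minimal or not,
forces it. In the syntactic monoid, two distinct `R`-equivalent elements form a cycle `s`, `s * a`,
`s * a * b = s`, and a cycle of quotients is pumped into such a cycle.

A formula is evaluated by a partially ordered transducer, where `P` costs one bit that is never
reset (`Formula.exists_partially_ordered_transducer`). The language of a state of a partially
ordered automaton splits at the first letter that leaves the state, which yields a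
left-deterministic polynomial by induction from the maximal states down. Finally, left-determinism
lets past logic locate each marked letter as the first one outside a subalphabet and relativize to
what follows (`IsDefinable.stringsOver_mul`). -/

/-- The left quotients of `L` form a partial order under reachability: a left quotient that is
reached again after reading `x ++ y` is not left by reading `x`. -/
def HasAcyclicQuotients (L : Language α) : Prop :=
  ∀ u x y : List α, L.leftQuotient (u ++ x ++ y) = L.leftQuotient u →
    L.leftQuotient (u ++ x) = L.leftQuotient u

theorem le_evalFrom [PartialOrder σ] {A : DFA α σ} (h : ∀ q a, q ≤ A.step q a) (q : σ)
    (x : List α) : q ≤ A.evalFrom q x := by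
  induction x generalizing q with
  | nil => exact le_rfl
  | cons a x ih => exact (h q a).trans (ih _)

theorem leftQuotient_append_flatten_replicate {L : Language α} {u z : List α}
    (h : L.leftQuotient (u ++ z) = L.leftQuotient u) (n : ℕ) :
    L.leftQuotient (u ++ (List.replicate n z).flatten) = L.leftQuotient u := by
  induction n with
  | zero => simp
  | succ n ih =>
    rw [List.replicate_succ, List.flatten_cons, ← List.append_assoc, Language.leftQuotient_append,
      h, ← Language.leftQuotient_append, ih]

theorem flatten_replicate_succ (n : ℕ) (z : List α) :
    (List.replicate (n + 1) z).flatten = (List.replicate n z).flatten ++ z := by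
  simp [List.replicate_succ']

theorem flatten_replicate_add (m n : ℕ) (z : List α) :
    (List.replicate (m + n) z).flatten =
      (List.replicate m z).flatten ++ (List.replicate n z).flatten := by
  rw [List.replicate_add, List.flatten_append]

/-- Since `A` need not be minimal, `z = x ++ y` may move the state although it fixes the quotient.
Along the powers of `z` the state climbs and finally stabilizes; there `x` is squeezed between two
equal states. -/
theorem IsPartiallyOrderedDFA.hasAcyclicQuotients [Finite σ] {A : DFA α σ} {L : Language α}
    (hA : A.accepts = L) (h : IsPartiallyOrderedDFA A) : HasAcyclicQuotients L := by
  obtain ⟨_, h⟩ := h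
  intro u x y huxy
  let z := x ++ y
  let f : ℕ →o σ := ⟨fun n => A.eval (u ++ (List.replicate n z).flatten),
    monotone_nat_of_le_succ fun n => by
      rw [flatten_replicate_succ, ← List.append_assoc]
      exact (le_evalFrom h _ z).trans_eq (A.evalFrom_of_append _ _ _).symm⟩
  obtain ⟨n, hn⟩ := WellFoundedGT.monotone_chain_condition f
  have hf : A.evalFrom (f n) x = f n := by
    refine le_antisymm ?_ (le_evalFrom h _ _)
    have h1 : f (n + 1) = A.evalFrom (A.evalFrom (f n) x) y := by
      simp only [f, OrderHom.coe_mk, DFA.eval]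
      rw [flatten_replicate_succ, ← List.append_assoc, A.evalFrom_of_append, A.evalFrom_of_append]
    exact (le_evalFrom h _ y).trans_eq (h1.symm.trans (hn (n + 1) n.le_succ).symm)
  have hz := leftQuotient_append_flatten_replicate (L := L) (u := u) (z := z)
    (by rwa [← List.append_assoc]) n
  rw [Language.leftQuotient_append, ← hz, ← Language.leftQuotient_append, ← hA,
    Language.leftQuotient_accepts_apply, Language.leftQuotient_accepts_apply, DFA.eval,
    A.evalFrom_of_append]
  exact congrArg _ hf

/-! ### Minimal automata -/

theorem IsMinimalDFA.card_le {A : DFA α σ} {L : Language α} (hA : IsMinimalDFA A L) [Finite τ]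
    (B : DFA α τ) (hB : B.accepts = L) : Nat.card σ ≤ Nat.card τ :=
  hA.2 _ (DFA.reindex (Finite.equivFin τ) B) (by rw [DFA.accepts_reindex, hB])

/-- Choosing a string for each quotient injects the quotients into the states. The quotients
themselves form an automaton for `L`, so minimality makes this injection bijective. -/
theorem IsMinimalDFA.exists_eval_eq_and_injective [Finite σ] {A : DFA α σ} {L : Language α}
    (hL : L.IsRegular) (hA : IsMinimalDFA A L) :
    (∀ q, ∃ u, A.eval u = q) ∧ Function.Injective A.acceptsFrom := by
  have : Finite (Set.range L.leftQuotient) := hL.finite_range_leftQuotient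
  choose g hg using fun Q : Set.range L.leftQuotient => Q.2
  have hg' (Q) : A.acceptsFrom (A.eval (g Q)) = Q := by
    rw [← Language.leftQuotient_accepts_apply, hA.1, hg]
  have hinj : Function.Injective fun Q => A.eval (g Q) := fun Q Q' h =>
    Subtype.ext <| by rw [← hg', ← hg' Q']; exact congrArg _ h
  have hsurj := (hinj.bijective_of_nat_card_le (hA.card_le _ L.accepts_toDFA)).2
  refine ⟨fun q => (hsurj q).imp' g fun _ => id, fun q q' h => ?_⟩
  obtain ⟨Q, rfl⟩ := hsurj q
  obtain ⟨Q', rfl⟩ := hsurj q'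
  simp only [hg'] at h
  rw [Subtype.ext h]

theorem HasAcyclicQuotients.isPartiallyOrderedDFA [Finite σ] {A : DFA α σ} {L : Language α}
    (hL : L.IsRegular) (hA : IsMinimalDFA A L) (h : HasAcyclicQuotients L) :
    IsPartiallyOrderedDFA A := by
  obtain ⟨hreach, hinj⟩ := hA.exists_eval_eq_and_injective hL
  refine ⟨{ le := fun q q' => ∃ x, A.evalFrom q x = q'
            le_refl := fun q => ⟨[], rfl⟩
            le_trans := ?_
            le_antisymm := ?_ }, fun q a => ⟨[a], rfl⟩⟩
  · rintro q _ _ ⟨x, rfl⟩ ⟨y, rfl⟩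
    exact ⟨x ++ y, A.evalFrom_of_append _ _ _⟩
  · rintro q _ ⟨x, rfl⟩ ⟨y, hy⟩
    obtain ⟨u, rfl⟩ := hreach q
    have := h u x y
    rw [← hA.1] at this
    simp only [Language.leftQuotient_accepts_apply, DFA.eval, A.evalFrom_of_append] at this hy
    exact (hinj (this (by rw [hy]))).symm

namespace PartialDFA

theorem evalFrom_append (B : PartialDFA α τ) (q : τ) (x y : List α) :
    B.evalFrom q (x ++ y) = (B.evalFrom q x).bind fun q' => B.evalFrom q' y := by
  induction x generalizing q with
  | nil => rfl
  | cons a x ih =>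
    simp only [List.cons_append, evalFrom]
    cases B.step q a with
    | none => rfl
    | some q' => exact ih q'

/-- The language accepted from the state `q`. -/
def acceptsFrom (B : PartialDFA α τ) (q : τ) : Language α :=
  {x | ∃ p ∈ B.accept, B.evalFrom q x = some p}

theorem mem_acceptsFrom {B : PartialDFA α τ} {q : τ} {x : List α} :
    x ∈ B.acceptsFrom q ↔ ∃ p ∈ B.accept, B.evalFrom q x = some p := Iff.rfl

theorem mem_accepts {B : PartialDFA α τ} {x : List α} :
    x ∈ B.accepts ↔ ∃ p ∈ B.accept, B.evalFrom B.start x = some p := Iff.rfl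

theorem leftQuotient_accepts {B : PartialDFA α τ} {u : List α} {q : τ}
    (h : B.evalFrom B.start u = some q) : B.accepts.leftQuotient u = B.acceptsFrom q := by
  ext x
  rw [Language.mem_leftQuotient, mem_accepts, mem_acceptsFrom, evalFrom_append, h]
  rfl

/-- The total automaton obtained by adding a rejecting sink `none`. -/
def toTotal (B : PartialDFA α τ) : DFA α (Option τ) where
  step q a := q.bind fun q => B.step q a
  start := some B.start
  accept := some '' B.accept

theorem evalFrom_toTotal (B : PartialDFA α τ) (q : Option τ) (x : List α) :
    B.toTotal.evalFrom q x = q.bind fun q => B.evalFrom q x := by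
  induction x generalizing q with
  | nil => cases q <;> rfl
  | cons a x ih =>
    rw [DFA.evalFrom_cons, ih]
    cases q <;> rfl

theorem accepts_toTotal (B : PartialDFA α τ) : B.toTotal.accepts = B.accepts := by
  ext x
  rw [DFA.mem_accepts, DFA.eval, evalFrom_toTotal, mem_accepts]
  simp only [toTotal, Option.bind_some, Set.mem_image, eq_comm]

theorem IsPartiallyOrdered.toTotal {B : PartialDFA α τ} (h : B.IsPartiallyOrdered) :
    IsPartiallyOrderedDFA B.toTotal := by
  obtain ⟨_, h⟩ := h
  -- The sink `none` becomes the top element.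
  refine ⟨inferInstanceAs (PartialOrder (WithTop τ)), fun q a => ?_⟩
  rcases q with _ | q
  · exact le_refl (⊤ : WithTop τ)
  · change (q : WithTop τ) ≤ (B.step q a : Option τ)
    rcases hq : B.step q a with _ | q'
    · exact le_top (a := (q : WithTop τ))
    · exact WithTop.coe_le_coe.2 (h q a q' hq)

/-- Renaming of states. -/
def reindex {ρ : Type*} (e : τ ≃ ρ) (B : PartialDFA α τ) : PartialDFA α ρ where
  step q a := (B.step (e.symm q) a).map e
  start := e B.start
  accept := e.symm ⁻¹' B.accept

theorem evalFrom_reindex {ρ : Type*} (e : τ ≃ ρ) (B : PartialDFA α τ) (q : τ) (x : List α) :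
    (B.reindex e).evalFrom (e q) x = (B.evalFrom q x).map e := by
  induction x generalizing q with
  | nil => rfl
  | cons a x ih =>
    simp only [evalFrom, reindex, Equiv.symm_apply_apply]
    cases B.step q a with
    | none => rfl
    | some q' => exact ih q'

theorem accepts_reindex {ρ : Type*} (e : τ ≃ ρ) (B : PartialDFA α τ) :
    (B.reindex e).accepts = B.accepts := by
  ext x
  rw [mem_accepts, mem_accepts]
  change (∃ p ∈ _, (B.reindex e).evalFrom (e B.start) x = _) ↔ _
  rw [evalFrom_reindex]
  simp [reindex]

theorem IsMinimal.card_le {B : PartialDFA α τ} {L : Language α} (hB : B.IsMinimal L)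
    {ρ : Type*} [Finite ρ] (C : PartialDFA α ρ) (hC : C.accepts = L) :
    Nat.card τ ≤ Nat.card ρ :=
  hB.2 _ (C.reindex (Finite.equivFin ρ)) (by rw [accepts_reindex, hC])

open Classical in
/-- The nonempty left quotients of a nonempty language, as the states of a partial automaton. -/
noncomputable def ofLanguage (L : Language α) (hL : ∃ x, x ∈ L) :
    PartialDFA α {Q // Q ∈ Set.range L.leftQuotient ∧ ∃ x, x ∈ Q} where
  step Q a := if h : ∃ x, x ∈ Q.1.leftQuotient [a] then
      some ⟨Q.1.leftQuotient [a], (L.toDFA.step ⟨Q.1, Q.2.1⟩ a).2, h⟩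
    else none
  start := ⟨L, ⟨[], rfl⟩, hL⟩
  accept := {Q | [] ∈ Q.1}

theorem acceptsFrom_ofLanguage {L : Language α} (hL : ∃ x, x ∈ L)
    (Q : {Q // Q ∈ Set.range L.leftQuotient ∧ ∃ x, x ∈ Q}) :
    (ofLanguage L hL).acceptsFrom Q = Q.1 := by
  ext x
  induction x generalizing Q with
  | nil => simp [mem_acceptsFrom, evalFrom, ofLanguage]
  | cons a x ih =>
    rw [mem_acceptsFrom]
    simp only [evalFrom]
    by_cases h : ∃ x, x ∈ Q.1.leftQuotient [a]
    · rw [show (ofLanguage L hL).step Q a = _ from dif_pos h]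
      exact ih _
    · rw [show (ofLanguage L hL).step Q a = _ from dif_neg h]
      have : a :: x ∉ Q.1 := fun hx => h ⟨x, hx⟩
      simp [this]

/-- As in the total case, but with nonempty quotients only: a string in the quotient by `u`
guarantees that the run on `u` is defined. -/
theorem IsMinimal.exists_eval_eq_and_injective [Finite τ] {B : PartialDFA α τ} {L : Language α}
    (hL : L.IsRegular) (hne : ∃ x, x ∈ L) (hB : B.IsMinimal L) :
    (∀ q, ∃ u, B.evalFrom B.start u = some q) ∧ Function.Injective B.acceptsFrom := by
  have : Finite {Q // Q ∈ Set.range L.leftQuotient ∧ ∃ x, x ∈ Q} :=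
    (hL.finite_range_leftQuotient.subset fun _ h => h.1 :
      Set.Finite {Q | Q ∈ Set.range L.leftQuotient ∧ ∃ x, x ∈ Q})
  have key (Q : {Q // Q ∈ Set.range L.leftQuotient ∧ ∃ x, x ∈ Q}) :
      ∃ q, (∃ u, B.evalFrom B.start u = some q) ∧ B.acceptsFrom q = Q.1 := by
    obtain ⟨Q, ⟨u, rfl⟩, x, hx⟩ := Q
    rw [Language.mem_leftQuotient, ← hB.1, mem_accepts, evalFrom_append] at hx
    obtain ⟨p, -, hp⟩ := hx
    obtain ⟨q, hq, -⟩ := Option.bind_eq_some_iff.1 hp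
    exact ⟨q, ⟨u, hq⟩, by rw [← leftQuotient_accepts hq, hB.1]⟩
  choose g hg hg' using key
  have hinj : Function.Injective g := fun Q Q' h => Subtype.ext <| by rw [← hg', ← hg' Q', h]
  have hsurj := (hinj.bijective_of_nat_card_le
    (hB.card_le (ofLanguage L hne) (acceptsFrom_ofLanguage hne _))).2
  refine ⟨fun q => ?_, fun q q' h => ?_⟩
  · obtain ⟨Q, rfl⟩ := hsurj q
    exact hg Q
  · obtain ⟨Q, rfl⟩ := hsurj q
    obtain ⟨Q', rfl⟩ := hsurj q'
    rw [hg', hg'] at h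
    rw [Subtype.ext h]

/-- The automaton with one state that accepts nothing. -/
def reject : PartialDFA α Unit where
  step _ _ := none
  start := ()
  accept := ∅

theorem IsMinimal.isPartiallyOrdered [Finite τ] {B : PartialDFA α τ} {L : Language α}
    (hL : L.IsRegular) (hB : B.IsMinimal L) (h : HasAcyclicQuotients L) :
    B.IsPartiallyOrdered := by
  by_cases hne : ∃ x, x ∈ L
  · obtain ⟨hreach, hinj⟩ := hB.exists_eval_eq_and_injective hL hne
    refine ⟨{ le := fun q q' => ∃ x, B.evalFrom q x = some q'
              le_refl := fun q => ⟨[], rfl⟩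
              le_trans := ?_
              le_antisymm := ?_ }, fun q a q' h => ⟨[a], by simp [evalFrom, h]⟩⟩
    · rintro q p r ⟨x, hx⟩ ⟨y, hy⟩
      exact ⟨x ++ y, by rw [evalFrom_append, hx]; exact hy⟩
    · rintro q p ⟨x, hx⟩ ⟨y, hy⟩
      obtain ⟨u, hu⟩ := hreach q
      have hux : B.evalFrom B.start (u ++ x) = some p := by rw [evalFrom_append, hu]; exact hx
      have huxy : B.evalFrom B.start (u ++ x ++ y) = some q := by
        rw [evalFrom_append, hux]; exact hy
      have := h u x y
      rw [← hB.1, leftQuotient_accepts hu, leftQuotient_accepts hux,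
        leftQuotient_accepts huxy] at this
      exact (hinj (this rfl)).symm
  -- The empty language has no nonempty quotient, yet an automaton needs a start state; a single
  -- state suffices.
  · have hcard : Nat.card τ ≤ 1 := by
      rw [← Nat.card_unique (α := Unit)]
      refine hB.card_le reject ?_
      ext x
      rw [mem_accepts]
      simp only [reject, Set.mem_empty_iff_false, false_and, exists_false, false_iff]
      exact fun hx => hne ⟨x, hx⟩
    have : Subsingleton τ := Finite.card_le_one_iff_subsingleton.1 hcard
    exact ⟨{ le := fun _ _ => True
             le_refl := fun _ => trivial
             le_trans := fun _ _ _ _ _ => trivial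
             le_antisymm := fun _ _ _ _ => Subsingleton.elim _ _ }, fun _ _ _ _ => trivial⟩

end PartialDFA

/-! ### The syntactic monoid -/

theorem syntacticCon_iff {L : Language α} {s t : FreeMonoid α} :
    syntacticCon L s t ↔ ∀ u : List α,
      L.leftQuotient (u ++ s.toList) = L.leftQuotient (u ++ t.toList) := by
  refine ⟨fun h u => ?_, fun h u x => ?_⟩
  · ext x
    exact h (FreeMonoid.ofList u) (FreeMonoid.ofList x)
  · have := congrArg (fun K : Language α => x.toList ∈ K) (h u.toList)
    exact this.to_iff

theorem HasAcyclicQuotients.isRTrivial {L : Language α} (h : HasAcyclicQuotients L) :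
    IsRTrivial (SyntacticMonoid L) := by
  intro s t hst
  obtain ⟨a, ha⟩ : t ∈ Set.range fun x => s * x := hst ▸ ⟨1, mul_one t⟩
  obtain ⟨b, hb⟩ : s ∈ Set.range fun x => t * x := hst ▸ ⟨1, mul_one s⟩
  subst ha
  induction s using Con.induction_on with | _ s
  induction a using Con.induction_on with | _ a
  induction b using Con.induction_on with | _ b
  simp only [← Con.coe_mul] at hb ⊢
  rw [Con.eq, syntacticCon_iff] at hb ⊢
  intro u
  have := h (u ++ s.toList) a.toList b.toList
  simp only [FreeMonoid.toList_mul, ← List.append_assoc] at hb ⊢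
  exact (this (hb u)).symm

/-- By pigeonhole two powers of `z = x ++ y` act alike on the states, say the `i`-th and the `(i + k
+ 1)`-th. Then `z ^ i` and `z ^ i * x` generate the same right ideal, hence are equal in the
syntactic monoid, and `z ^ i` does not change the quotient by `u`. -/
theorem IsRTrivial.hasAcyclicQuotients [Finite σ] {A : DFA α σ} {L : Language α}
    (hA : A.accepts = L) (h : IsRTrivial (SyntacticMonoid L)) : HasAcyclicQuotients L := by
  intro u x y huxy
  let z := x ++ y
  obtain ⟨i, j, hij, hf⟩ : ∃ i j, i < j ∧
      (fun q => A.evalFrom q (List.replicate i z).flatten) =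
        fun q => A.evalFrom q (List.replicate j z).flatten := by
    obtain ⟨i, j, hne, hf⟩ := Finite.exists_ne_map_eq_of_infinite fun (n : ℕ) (q : σ) =>
      A.evalFrom q (List.replicate n z).flatten
    rcases hne.lt_or_gt with hlt | hlt
    · exact ⟨i, j, hlt, hf⟩
    · exact ⟨j, i, hlt, hf.symm⟩
  obtain ⟨k, rfl⟩ := Nat.exists_eq_add_of_lt hij
  let s : SyntacticMonoid L := (FreeMonoid.ofList (List.replicate i z).flatten : FreeMonoid α)
  let a : SyntacticMonoid L := (FreeMonoid.ofList x : FreeMonoid α)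
  -- Chosen so that `a * b` is the class of the power `k + 1` of `z`.
  let b : SyntacticMonoid L :=
    (FreeMonoid.ofList (y ++ (List.replicate k z).flatten) : FreeMonoid α)
  have hs : s * a * b = s := by
    simp only [s, a, b, ← Con.coe_mul]
    rw [Con.eq, syntacticCon_iff]
    intro u
    rw [← hA, Language.leftQuotient_accepts_apply, Language.leftQuotient_accepts_apply, DFA.eval,
      A.evalFrom_of_append, A.evalFrom_of_append]
    have := congrFun hf (A.evalFrom A.start u)
    rw [add_assoc, flatten_replicate_add, add_comm k 1, flatten_replicate_add] at this
    simp only [List.replicate_one, List.flatten_singleton, z, List.append_assoc] at this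
    simp only [FreeMonoid.toList_mul, FreeMonoid.toList_ofList, List.append_assoc, z, this]
  have hsa : s = s * a := by
    refine h _ _ (Set.Subset.antisymm ?_ ?_)
    · rintro _ ⟨c, rfl⟩
      refine ⟨b * c, ?_⟩
      simp only [← mul_assoc, hs]
    · rintro _ ⟨c, rfl⟩
      exact ⟨a * c, by simp only [mul_assoc]⟩
  simp only [s, a, ← Con.coe_mul] at hsa
  rw [Con.eq, syntacticCon_iff] at hsa
  have hz := leftQuotient_append_flatten_replicate (L := L) (u := u) (z := z)
    (by rwa [← List.append_assoc]) i
  have := hsa u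
  rw [FreeMonoid.toList_mul, ← List.append_assoc] at this
  simp only [FreeMonoid.toList_ofList] at this
  rw [hz, Language.leftQuotient_append, hz, ← Language.leftQuotient_append] at this
  exact this.symm

/-! ### From formulas to automata -/

/-- The output sees the current symbol (`none` beyond the end) besides the state, so that atoms need
no memory and the state depends only on earlier positions. -/
theorem Formula.exists_partially_ordered_transducer (φ : Formula α) :
    ∃ (Q : Type) (_ : PartialOrder Q) (_ : Finite Q) (step : Q → α → Q) (start : Q)
      (out : Q → Option α → Prop), (∀ q a, q ≤ step q a) ∧
      ∀ (w : List α) (n : ℕ), n ≤ w.length →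
        (φ.Sat w n ↔ out ((w.take n).foldl step start) w[n]?) := by
  induction φ with
  | atom a =>
    exact ⟨Unit, inferInstance, inferInstance, fun q _ => q, (), fun _ b => b = some a,
      fun _ _ => le_rfl, fun _ _ _ => Iff.rfl⟩
  | and φ ψ ih₁ ih₂ =>
    obtain ⟨Q₁, _, _, s₁, q₁, o₁, hs₁, h₁⟩ := ih₁
    obtain ⟨Q₂, _, _, s₂, q₂, o₂, hs₂, h₂⟩ := ih₂
    refine ⟨Q₁ × Q₂, inferInstance, inferInstance, fun q a => (s₁ q.1 a, s₂ q.2 a), (q₁, q₂),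
      fun q b => o₁ q.1 b ∧ o₂ q.2 b, fun q a => ⟨hs₁ _ _, hs₂ _ _⟩, fun w n hn => ?_⟩
    have key (x : List α) (p₁ : Q₁) (p₂ : Q₂) :
        x.foldl (fun (q : Q₁ × Q₂) a => (s₁ q.1 a, s₂ q.2 a)) (p₁, p₂) =
          (x.foldl s₁ p₁, x.foldl s₂ p₂) := by
      induction x generalizing p₁ p₂ with
      | nil => rfl
      | cons a x ih => exact ih _ _
    rw [key, Formula.Sat, h₁ w n hn, h₂ w n hn]
  | not φ ih =>
    obtain ⟨Q, hQ, hQ', s, q, o, hs, h⟩ := ih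
    exact ⟨Q, hQ, hQ', s, q, fun q b => ¬ o q b, hs, fun w n hn => not_congr (h w n hn)⟩
  | past φ ih =>
    obtain ⟨Q, _, _, s, q₀, o, hs, h⟩ := ih
    -- The second component records whether `φ` held at an earlier position; it can only rise from
    -- `False` to `True`.
    refine ⟨Q × Prop, inferInstance, inferInstance, fun q a => (s q.1 a, q.2 ∨ o q.1 (some a)),
      (q₀, False), fun q _ => q.2, fun q a => ⟨hs _ _, fun hq => Or.inl hq⟩, fun w n hn => ?_⟩
    have key : (w.take n).foldl (fun (q : Q × Prop) a => (s q.1 a, q.2 ∨ o q.1 (some a)))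
        (q₀, False) = ((w.take n).foldl s q₀, (Formula.past φ).Sat w n) := by
      induction n with
      | zero => simp [Formula.Sat]
      | succ n ih =>
        have hn' : n < w.length := hn
        rw [List.take_succ_eq_append_getElem hn', List.foldl_append, List.foldl_append,
          ih hn'.le]
        refine Prod.ext rfl (propext ?_)
        have hw := h w n hn'.le
        rw [List.getElem?_eq_getElem hn'] at hw
        simp only [List.foldl_cons, List.foldl_nil, Formula.Sat, ← hw, Nat.lt_succ_iff_lt_or_eq,
          or_and_right, exists_or, exists_eq_left]
    rw [key]

theorem IsDefinable.hasAcyclicQuotients {L : Language α} (h : IsDefinable L) :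
    HasAcyclicQuotients L := by
  obtain ⟨φ, rfl⟩ := h
  obtain ⟨Q, hQ, _, s, q, o, hs, h⟩ := φ.exists_partially_ordered_transducer
  refine IsPartiallyOrderedDFA.hasAcyclicQuotients (A := ⟨s, q, {q | o q none}⟩) ?_ ⟨hQ, hs⟩
  ext w
  have := h w w.length le_rfl
  rw [List.take_length, List.getElem?_eq_none le_rfl] at this
  exact this.symm

/-! ### From automata to left-deterministic polynomials -/

theorem mem_stringsOver {S : Set α} {w : List α} : w ∈ stringsOver S ↔ ∀ a ∈ w, a ∈ S := Iff.rfl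

theorem mem_stringsOver_mul {S : Set α} {a : α} {K : Language α} {w : List α} :
    w ∈ stringsOver S * {[a]} * K ↔ ∃ s t, (∀ b ∈ s, b ∈ S) ∧ t ∈ K ∧ w = s ++ a :: t := by
  constructor
  · intro h
    obtain ⟨x, hx, t, ht, rfl⟩ := Language.mem_mul.1 h
    obtain ⟨s, hs, y, hy, rfl⟩ := Language.mem_mul.1 hx
    obtain rfl : y = [a] := hy
    exact ⟨s, t, hs, ht, by simp⟩
  · rintro ⟨s, t, hs, ht, rfl⟩
    rw [List.append_cons]
    exact Language.append_mem_mul (Language.append_mem_mul hs rfl) ht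

/-- Both `a` and `a'` sit at the first position outside `S`. -/
theorem append_cons_inj_of_notMem {S : Set α} {s s' t t' : List α} {a a' : α}
    (hs : ∀ b ∈ s, b ∈ S) (hs' : ∀ b ∈ s', b ∈ S) (ha : a ∉ S) (ha' : a' ∉ S)
    (h : s ++ a :: t = s' ++ a' :: t') : s = s' ∧ a = a' ∧ t = t' := by
  induction s generalizing s' with
  | nil =>
    cases s' with
    | nil => simpa using h
    | cons b s' =>
      obtain ⟨rfl, -⟩ := List.cons.inj h
      exact absurd (hs' a (by simp)) ha
  | cons b s ih =>
    cases s' with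
    | nil =>
      obtain ⟨rfl, -⟩ := List.cons.inj h
      exact absurd (hs b (by simp)) ha'
    | cons b' s' =>
      obtain ⟨rfl, htl⟩ := List.cons.inj h
      obtain ⟨rfl, h'⟩ := ih (s' := s') (fun c hc => hs c (by simp [hc]))
        (fun c hc => hs' c (by simp [hc])) htl
      exact ⟨rfl, h'⟩

theorem IsLeftDetMonomial.stringsOver_mul {S : Set α} {a : α} (ha : a ∉ S) {K : Language α}
    (hK : IsLeftDetMonomial K) : IsLeftDetMonomial (stringsOver S * {[a]} * K) := by
  obtain ⟨l, T, hl, rfl⟩ := hK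
  refine ⟨(S, a) :: l, T, ?_, rfl⟩
  exact List.forall_mem_cons.2 ⟨ha, hl⟩

theorem disjoint_of_forall {K K' : Language α} (h : ∀ w, w ∈ K → w ∉ K') : Disjoint K K' :=
  Set.disjoint_left (s := (K : Set (List α))).2 fun w => h w

theorem notMem_of_disjoint {K K' : Language α} (h : Disjoint K K') {w : List α} (hw : w ∈ K) :
    w ∉ K' :=
  Set.disjoint_left (s := (K : Set (List α))).1 h hw

/-- Splitting the strings of a language at the first letter that is not in `S`. -/
theorem IsLeftDetPolynomial.of_first_notMem [Finite α] {S : Set α} {K : α → Language α}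
    (hK : ∀ a ∉ S, IsLeftDetPolynomial (K a)) (p : Prop) {L : Language α}
    (hL : ∀ w, w ∈ L ↔ p ∧ w ∈ stringsOver S ∨ ∃ a ∉ S, w ∈ stringsOver S * {[a]} * K a) :
    IsLeftDetPolynomial L := by
  choose! F hF hmon hdisj hmem using hK
  let G : Set (Language α) := ⋃ a ∈ Sᶜ, (fun M => stringsOver S * {[a]} * M) '' F a
  -- Empty when `p` fails, so one construction covers accepting and rejecting states.
  let H : Set (Language α) := {M | p ∧ M = stringsOver S}
  have hG {M} : M ∈ G ↔ ∃ a ∉ S, ∃ N ∈ F a, stringsOver S * {[a]} * N = M := by simp [G]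
  have hHG {M N w} (hM : M ∈ H) (hN : N ∈ G) (hw : w ∈ M) : w ∉ N := by
    obtain ⟨-, rfl⟩ := hM
    obtain ⟨a, ha, N, -, rfl⟩ := hG.1 hN
    rw [mem_stringsOver_mul]
    rintro ⟨s, t, -, -, rfl⟩
    exact ha (hw a (by simp))
  refine ⟨H ∪ G, ?_, ?_, ?_, fun w => ?_⟩
  · exact ((Set.finite_singleton (stringsOver S)).subset fun M hM => hM.2).union
      ((Set.toFinite _).biUnion fun a ha => (hF a ha).image _)
  · rintro M (⟨-, rfl⟩ | hM)
    · exact ⟨[], S, by simp, rfl⟩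
    · obtain ⟨a, ha, N, hN, rfl⟩ := hG.1 hM
      exact (hmon a ha N hN).stringsOver_mul ha
  · rintro M (hM | hM) N (hN | hN) hne
    · exact absurd (hM.2.trans hN.2.symm) hne
    · exact disjoint_of_forall fun w => hHG hM hN
    · exact (disjoint_of_forall fun w => hHG hN hM).symm
    · obtain ⟨a, ha, M, hM', rfl⟩ := hG.1 hM
      obtain ⟨b, hb, N, hN', rfl⟩ := hG.1 hN
      refine disjoint_of_forall fun w hw hw' => ?_
      obtain ⟨s, t, hs, ht, rfl⟩ := mem_stringsOver_mul.1 hw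
      obtain ⟨s', t', hs', ht', h⟩ := mem_stringsOver_mul.1 hw'
      -- Unique factorization reduces disjointness to that of the tails.
      obtain ⟨rfl, rfl, rfl⟩ := append_cons_inj_of_notMem hs hs' ha hb h
      refine notMem_of_disjoint (hdisj a ha hM' hN' ?_) ht ht'
      rintro rfl
      exact hne rfl
  · rw [hL]
    constructor
    · rintro (⟨hp, hw⟩ | ⟨a, ha, hw⟩)
      · exact ⟨_, Or.inl ⟨hp, rfl⟩, hw⟩
      · obtain ⟨s, t, hs, ht, rfl⟩ := mem_stringsOver_mul.1 hw
        obtain ⟨N, hN, ht⟩ := (hmem a ha t).1 ht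
        exact ⟨_, Or.inr (hG.2 ⟨a, ha, N, hN, rfl⟩), mem_stringsOver_mul.2 ⟨s, t, hs, ht, rfl⟩⟩
    · rintro ⟨M, hM | hM, hw⟩
      · obtain ⟨hp, rfl⟩ := hM
        exact Or.inl ⟨hp, hw⟩
      · obtain ⟨a, ha, N, hN, rfl⟩ := hG.1 hM
        obtain ⟨s, t, hs, ht, rfl⟩ := mem_stringsOver_mul.1 hw
        exact Or.inr ⟨a, ha, mem_stringsOver_mul.2 ⟨s, t, hs, (hmem a ha t).2 ⟨N, hN, ht⟩, rfl⟩⟩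

theorem evalFrom_of_forall_step_eq {A : DFA α σ} {q : σ} {s : List α}
    (hs : ∀ a ∈ s, A.step q a = q) : A.evalFrom q s = q := by
  induction s with
  | nil => rfl
  | cons a s ih =>
    rw [DFA.evalFrom_cons, hs a (by simp)]
    exact ih fun b hb => hs b (by simp [hb])

theorem forall_mem_or_exists_first_notMem (S : Set α) (w : List α) :
    (∀ a ∈ w, a ∈ S) ∨ ∃ s a t, (∀ b ∈ s, b ∈ S) ∧ a ∉ S ∧ w = s ++ a :: t := by
  induction w with
  | nil => simp
  | cons b w ih =>
    by_cases hb : b ∈ S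
    · rcases ih with h | ⟨s, a, t, hs, ha, rfl⟩
      · exact Or.inl (by simpa using ⟨hb, h⟩)
      · exact Or.inr ⟨b :: s, a, t, by simpa using ⟨hb, hs⟩, ha, rfl⟩
    · exact Or.inr ⟨[], b, w, by simp, hb, rfl⟩

/-- Let `S` be the set of letters that loop at `q`. The first letter outside `S` leads to a strictly
larger state, to which the induction hypothesis applies; strings over `S` count iff `q` accepts. -/
theorem IsPartiallyOrderedDFA.isLeftDetPolynomial [Finite α] [Finite σ] {A : DFA α σ}
    {L : Language α} (hA : A.accepts = L) (h : IsPartiallyOrderedDFA A) :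
    IsLeftDetPolynomial L := by
  obtain ⟨_, h⟩ := h
  suffices ∀ q, IsLeftDetPolynomial (A.acceptsFrom q) from hA ▸ this A.start
  intro q
  induction q using WellFoundedGT.induction with | _ q ih
  refine .of_first_notMem (S := {a | A.step q a = q}) (K := fun a => A.acceptsFrom (A.step q a))
    (fun a ha => ih _ ((h q a).lt_of_ne' ha)) (q ∈ A.accept) fun w => ?_
  have key {s t : List α} {a : α} (hs : ∀ b ∈ s, A.step q b = q) :
      s ++ a :: t ∈ A.acceptsFrom q ↔ t ∈ A.acceptsFrom (A.step q a) := by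
    rw [DFA.mem_acceptsFrom, DFA.mem_acceptsFrom, A.evalFrom_of_append,
      evalFrom_of_forall_step_eq hs, DFA.evalFrom_cons]
  constructor
  · intro hw
    rcases forall_mem_or_exists_first_notMem {a | A.step q a = q} w with hS | ⟨s, a, t, hs, ha, rfl⟩
    · rw [DFA.mem_acceptsFrom, evalFrom_of_forall_step_eq hS] at hw
      exact Or.inl ⟨hw, hS⟩
    · exact Or.inr ⟨a, ha, mem_stringsOver_mul.2 ⟨s, t, hs, (key hs).1 hw, rfl⟩⟩
  · rintro (⟨hq, hw⟩ | ⟨a, -, hw⟩)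
    · rwa [DFA.mem_acceptsFrom, evalFrom_of_forall_step_eq hw]
    · obtain ⟨s, t, hs, ht, rfl⟩ := mem_stringsOver_mul.1 hw
      exact (key hs).2 ht

/-! ### From left-deterministic polynomials to formulas -/

theorem Formula.exists_sat_iff_exists_mem [Nonempty α] {ι : Type*} {T : Set ι} (hT : T.Finite)
    (f : ι → Formula α) : ∃ φ : Formula α, ∀ w n, φ.Sat w n ↔ ∃ i ∈ T, (f i).Sat w n := by
  induction T, hT using Set.Finite.induction_on with
  | empty =>
    obtain ⟨a⟩ := ‹Nonempty α›
    -- The empty disjunction is a contradiction, and writing one requires a letter.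
    exact ⟨.and (.atom a) (.not (.atom a)), fun w n => by simp [Formula.Sat]⟩
  | @insert i T _ _ ih =>
    obtain ⟨φ, hφ⟩ := ih
    refine ⟨.not (.and (.not (f i)) (.not φ)), fun w n => ?_⟩
    simp only [Formula.Sat, hφ, Set.exists_mem_insert, not_and_or, not_not]

theorem Formula.exists_sat_iff_notMem [Finite α] [Nonempty α] (S : Set α) :
    ∃ φ : Formula α, ∀ w n, φ.Sat w n ↔ ∃ a ∉ S, w[n]? = some a :=
  Formula.exists_sat_iff_exists_mem (Set.toFinite Sᶜ) Formula.atom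

/-- The relativization of `φ` to the positions that satisfy `θ`. -/
def Formula.relativize : Formula α → Formula α → Formula α
  | .atom a, _ => .atom a
  | .and φ ψ, θ => .and (φ.relativize θ) (ψ.relativize θ)
  | .not φ, θ => .not (φ.relativize θ)
  | .past φ, θ => .past (.and θ (φ.relativize θ))

/-- The guard `θ` hides the positions of `s` from every `P`, so evaluation in `s ++ t` is that in
`t`, shifted by `s.length`. -/
theorem Formula.sat_relativize {θ : Formula α} {s t : List α}
    (hθ : ∀ m, θ.Sat (s ++ t) m ↔ s.length ≤ m) (φ : Formula α) (n : ℕ) :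
    (φ.relativize θ).Sat (s ++ t) (s.length + n) ↔ φ.Sat t n := by
  induction φ generalizing n with
  | atom a =>
    simp only [Formula.relativize, Formula.Sat]
    rw [List.getElem?_append_right (Nat.le_add_right _ _), Nat.add_sub_cancel_left]
  | and φ ψ ih₁ ih₂ => exact and_congr (ih₁ n) (ih₂ n)
  | not φ ih => exact not_congr (ih n)
  | past φ ih =>
    simp only [Formula.relativize, Formula.Sat, hθ]
    constructor
    · rintro ⟨m, hm, hsm, h⟩
      obtain ⟨k, rfl⟩ := Nat.exists_eq_add_of_le hsm
      exact ⟨k, by omega, (ih k).1 h⟩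
    · rintro ⟨k, hk, h⟩
      exact ⟨s.length + k, by omega, by omega, (ih k).2 h⟩

theorem Formula.mem_language {φ : Formula α} {w : List α} :
    w ∈ φ.language ↔ φ.Sat w w.length := Iff.rfl

theorem isDefinable_stringsOver [Finite α] [Nonempty α] (S : Set α) :
    IsDefinable (stringsOver S) := by
  obtain ⟨ν, hν⟩ := Formula.exists_sat_iff_notMem S
  refine ⟨.not (.past ν), ?_⟩
  ext w
  rw [Formula.mem_language, mem_stringsOver]
  simp only [Formula.Sat, hν]
  constructor
  · intro h a ha
    by_contra haS
    obtain ⟨m, hm, rfl⟩ := List.mem_iff_getElem.1 ha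
    exact h ⟨m, hm, _, haS, List.getElem?_eq_getElem hm⟩
  · rintro h ⟨m, -, a, haS, ha⟩
    exact haS (h a (List.mem_of_getElem? ha))

/-- With `ν` marking the letters outside `S`, the first conjunct says that the first such letter
exists and is `a`. Then `P ν` holds exactly at the positions strictly after it, so it can serve as
the guard for the formula of `K`. -/
theorem IsDefinable.stringsOver_mul [Finite α] [Nonempty α] {S : Set α} {a : α} (ha : a ∉ S)
    {K : Language α} (hK : IsDefinable K) : IsDefinable (stringsOver S * {[a]} * K) := by
  obtain ⟨φ, rfl⟩ := hK
  obtain ⟨ν, hν⟩ := Formula.exists_sat_iff_notMem S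
  refine ⟨.and (.past (.and (.atom a) (.not (.past ν)))) (φ.relativize (.past ν)), ?_⟩
  have key {s t : List α} (hs : ∀ b ∈ s, b ∈ S) :
      (φ.relativize (.past ν)).Sat (s ++ a :: t) (s ++ a :: t).length ↔ φ.Sat t t.length := by
    have := Formula.sat_relativize (θ := .past ν) (s := s ++ [a]) (t := t) (fun m => ?_) φ t.length
    · rw [← this]
      simp [add_assoc, add_comm 1]
    · simp only [Formula.Sat, hν]
      constructor
      · rintro ⟨k, hk, b, hb, h⟩
        by_contra hm
        have hks : k < s.length := by simp at hm; omega
        rw [List.append_assoc, List.getElem?_append_left hks] at h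
        exact hb (hs b (List.mem_of_getElem? h))
      · intro hm
        exact ⟨s.length, by simpa using hm, a, ha, by simp⟩
  ext w
  rw [Formula.mem_language, mem_stringsOver_mul]
  constructor
  · rintro ⟨⟨m, hm, hma, hS⟩, h⟩
    have hw : w = w.take m ++ a :: w.drop (m + 1) := by
      obtain ⟨-, rfl⟩ := List.getElem?_eq_some_iff.1 hma
      simp
    have hs : ∀ b ∈ w.take m, b ∈ S := by
      intro b hb
      by_contra hbS
      obtain ⟨k, hk, rfl⟩ := List.mem_iff_getElem.1 hb
      rw [List.length_take] at hk
      refine hS ⟨k, by omega, (hν _ _).2 ⟨_, hbS, ?_⟩⟩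
      rw [List.getElem_take, List.getElem?_eq_getElem]
    refine ⟨_, _, hs, ?_, hw⟩
    rw [hw] at h
    exact (key hs).1 h
  · rintro ⟨s, t, hs, ht, rfl⟩
    refine ⟨⟨s.length, by simp, by simp [Formula.Sat], ?_⟩, (key hs).2 ht⟩
    rintro ⟨k, hk, h⟩
    obtain ⟨b, hb, h⟩ := (hν _ _).1 h
    rw [List.getElem?_append_left hk] at h
    exact hb (hs b (List.mem_of_getElem? h))

theorem IsLeftDetMonomial.isDefinable [Finite α] [Nonempty α] {K : Language α}
    (hK : IsLeftDetMonomial K) : IsDefinable K := by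
  obtain ⟨l, S, hl, rfl⟩ := hK
  induction l with
  | nil => exact isDefinable_stringsOver S
  | cons p l ih =>
    exact (ih fun q hq => hl q (by simp [hq])).stringsOver_mul (hl p (by simp))

theorem IsLeftDetPolynomial.isDefinable [Finite α] [Nonempty α] {L : Language α}
    (hL : IsLeftDetPolynomial L) : IsDefinable L := by
  obtain ⟨F, hF, hmon, -, hmem⟩ := hL
  have : Nonempty (Formula α) := ‹Nonempty α›.map Formula.atom
  choose! f hf using fun K hK => (hmon K hK).isDefinable
  obtain ⟨φ, hφ⟩ := Formula.exists_sat_iff_exists_mem hF f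
  refine ⟨φ, ?_⟩
  ext w
  rw [Formula.mem_language, hφ, hmem]
  refine exists_congr fun K => and_congr_right fun hK => ?_
  rw [← Formula.mem_language, hf K hK]

end PastLogic

theorem mainTheorem3 {α : Type*} [Finite α] [Nonempty α] (L : Language α) (hL : L.IsRegular)
    {σ : Type*} [Finite σ] (A : DFA α σ) (hA : PastLogic.IsMinimalDFA A L)
    {τ : Type*} [Finite τ] (B : PastLogic.PartialDFA α τ) (hB : B.IsMinimal L) :
    List.TFAE
      [PastLogic.IsLeftDetPolynomial L,
       PastLogic.IsRTrivial (PastLogic.SyntacticMonoid L),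
       PastLogic.IsPartiallyOrderedDFA A,
       B.IsPartiallyOrdered,
       PastLogic.IsDefinable L] := by
  tfae_have 1 → 5 := fun h => h.isDefinable
  tfae_have 5 → 2 := fun h => h.hasAcyclicQuotients.isRTrivial
  tfae_have 2 → 4 := fun h => hB.isPartiallyOrdered hL (h.hasAcyclicQuotients hA.1)
  -- `B.toTotal` need not be minimal, so the order is transferred to `A` through the quotients.
  tfae_have 4 → 3 := fun h =>
    (h.toTotal.hasAcyclicQuotients (B.accepts_toTotal.trans hB.1)).isPartiallyOrderedDFA hL hA
  tfae_have 3 → 1 := fun h => h.isLeftDetPolynomial hA.1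
  tfae_finish
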